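/- **Theorem 2 (Limit cases).** Let $\alpha\neq 0$, $\sigma\notin\{0,1\}$, $K>0$ and $C$ be real. Let ${}_2F_1(a,b;c;z)=\sum_{n\ge 0}\frac{(a)_n(b)_n}{(c)_n}\frac{z^n}{n!}$ for $|z|<1$, and for real $z\le -1$ let ${}_2F_1(a,b;c;z)$ denote the value of the analytic continuation of this function to $(-\infty,1)$. For $\beta\in(0,1)$ and $q\ge 0$ with $1+\alpha\sigma q>0$, let $$u_{\beta,C}(q)=\frac{K\sigma}{\sigma-1}(1+\alpha\sigma q)^{\beta-\frac1\sigma}q^{1-\beta}\left[1+\frac{\beta-\frac1\sigma}{1-\beta}\,{}_2F_1\!\left(1-\tfrac1\sigma,1;2-\beta;-\alpha\sigma q\right)\right]+C$$ be the utility function with linear fractional relative risk aversion $-\frac{q u''(q)}{u'(q)}=\frac{\alpha q+\beta}{\alpha\sigma q+1}$. 1. (HARA) For every $q\ge 0$ with $1+\alpha\sigma q>0$, $$\lim_{\beta\to0^+}u_{\beta,C}(q)=\frac{K}{\alpha(\sigma-1)}\left[(1+\alpha\sigma q)^{\frac{\sigma-1}{\sigma}}-1\right]+C.$$ 2. (CREMR)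 Suppose that $1+\frac1\sigma$ is not a non-positive integer, and let the additive constant depend on $\beta$ (but not on $q$) as $$C_\beta=\frac{K\sigma}{\sigma-1}\,\frac{\Gamma(1-\beta)\,\Gamma(\frac1\sigma)}{\Gamma(\frac1\sigma-\beta)}\left(\frac{1}{\alpha\sigma}\right)^{1-\beta}+C .$$ Then, for every $q>0$ with $1+\alpha\sigma q>0$ and $\left|-\frac{1}{\alpha\sigma q}\right|<1$ (so that $\alpha\sigma>0$), $$\lim_{\beta\to1^-}u_{\beta,C_\beta}(q)=\frac{K\sigma}{\sigma-1}\,\frac{(1+\alpha\sigma q)^{1-\frac1\sigma}}{q}\left[q-\frac{\sigma-1}{\alpha\sigma}\,{}_2F_1\!\left(1,1;1+\tfrac1\sigma;-\tfrac{1}{\alpha\sigma q}\right)\right]+C .$$ -/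

import Mathlib

open Filter Topology

/-- `F` is the analytic continuation to the half-line `(-∞, 1)` of the Gauss hypergeometric
series `∑ (a)ₙ (b)ₙ / (c)ₙ · zⁿ / n!`, which converges for `|z| < 1`. -/
def IsGaussContinuation (a b c : ℝ) (F : ℝ → ℝ) : Prop :=
  AnalyticOnNhd ℝ F (Set.Iio 1) ∧ ∀ z : ℝ, |z| < 1 → F z = ₂F₁ a b c z

/-- The analytic continuation of the Gauss hypergeometric series is unique on `(-∞, 1)`. -/
theorem IsGaussContinuation.eqOn {a b c : ℝ} {F G : ℝ → ℝ}
    (hF : IsGaussContinuation a b c F) (hG : IsGaussContinuation a b c G) :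
    Set.EqOn F G (Set.Iio 1) := by
  refine hF.1.eqOn_of_preconnected_of_eventuallyEq hG.1 isPreconnected_Iio
    (z₀ := 0) (by simp) ?_
  filter_upwards [Ioo_mem_nhds (show (-1 : ℝ) < 0 by norm_num) (show (0 : ℝ) < 1 by norm_num)]
    with z hz
  rw [hF.2 z (abs_lt.2 hz), hG.2 z (abs_lt.2 hz)]

open Classical in
/-- The Gauss hypergeometric function `₂F₁(a, b; c; z)` of a real argument `z < 1`: the sum of
the power series for `|z| < 1`, and its analytic continuation for `z ≤ -1`. -/
noncomputable def gaussF (a b c : ℝ) : ℝ → ℝ :=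
  if h : ∃ F : ℝ → ℝ, IsGaussContinuation a b c F then h.choose else ₂F₁ a b c

theorem gaussF_eq_series (a b c : ℝ) {z : ℝ} (hz : |z| < 1) : gaussF a b c z = ₂F₁ a b c z := by
  unfold gaussF
  split_ifs with h
  · exact h.choose_spec.2 z hz
  · rfl

theorem gaussF_eq_of_isGaussContinuation {a b c : ℝ} {F : ℝ → ℝ}
    (hF : IsGaussContinuation a b c F) {z : ℝ} (hz : z < 1) : gaussF a b c z = F z := by
  have h : ∃ F : ℝ → ℝ, IsGaussContinuation a b c F := ⟨F, hF⟩
  unfold gaussF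
  rw [dif_pos h]
  exact h.choose_spec.eqOn hF hz

/-- The utility function with linear fractional relative risk aversion
`-q u''(q) / u'(q) = (α q + β) / (α σ q + 1)`, with multiplicative constant `K` and additive
constant `C`. It is meant for `β ∈ (0,1)`, `σ ∉ {0,1}`, `q ≥ 0` and `1 + α σ q > 0`. -/
noncomputable def lfrraUtility (α β σ K C q : ℝ) : ℝ :=
  K * σ / (σ - 1) * (1 + α * σ * q) ^ (β - 1 / σ) * q ^ (1 - β) *
      (1 + (β - 1 / σ) / (1 - β) * gaussF (1 - 1 / σ) 1 (2 - β) (-(α * σ * q))) + C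

/-- The HARA utility function, with constants `K` and `C`. -/
noncomputable def haraUtility (α σ K C q : ℝ) : ℝ :=
  K / (α * (σ - 1)) * ((1 + α * σ * q) ^ ((σ - 1) / σ) - 1) + C

/-- The CREMR utility function, with constants `K` and `C`, for `|-1 / (α σ q)| < 1`. -/
noncomputable def cremrUtility (α σ K C q : ℝ) : ℝ :=
  K * σ / (σ - 1) * ((1 + α * σ * q) ^ (1 - 1 / σ) / q) *
      (q - (σ - 1) / (α * σ) * ₂F₁ (1 : ℝ) 1 (1 + 1 / σ) (-(1 / (α * σ * q)))) + C

/-- The part of the additive constant of `lfrraUtility` that depends on `β` (but not on `q`) and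
diverges as `β → 1⁻`; it has to be removed for a limit to exist. -/
noncomputable def cremrShift (α β σ K : ℝ) : ℝ :=
  K * σ / (σ - 1) * (Real.Gamma (1 - β) * Real.Gamma (1 / σ) / Real.Gamma (1 / σ - β)) *
    (1 / (α * σ)) ^ (1 - β)

/-!
The proof rests on Euler's integral `E(a, b, z) = b ∫₀¹ (1 - t)ᵇ⁻¹ (1 - z t)⁻ᵃ dt` with `b > 0`.
Integrating the binomial series termwise shows that it equals `₂F₁(a, 1; b + 1; z)` for `|z| < 1`
(`eulerIntegral_eq_ordinaryHypergeometric`) and, by expansion about any other point, that it is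
analytic for `z < 1` (`analyticOnNhd_eulerIntegral`). So it is the analytic continuation, and the
utility function is expressed through `E(1 - s, 1 - β, -x)`, where `s = 1 / σ` and `x = α σ q`.

As `β → 0⁺` the integral converges, by dominated convergence, to `∫₀¹ (1 + x t)ˢ⁻¹ dt`, which is
`((1 + x)ˢ - 1) / (s x)`; this is the HARA limit.

As `β → 1⁻`, with `x > 1`, the factor `1 / (1 - β)` diverges. The connection formula
(`eulerIntegral_eq_connection`) writes, with `b = 1 - β`,
`E(1 - s, b, -x) = Γ(b + 1) Γ(s) / Γ(b + s) x⁻ᵇ (1 + x)ᵇ⁺ˢ⁻¹ - b / (s x) ₂F₁(1 - b, 1; s + 1; -1 / x)`.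
The contribution of its first term does not depend on `q` and is cancelled exactly by the shift of
the additive constant; the factor `b` of the second term cancels the divergence, and the limit follows
from the continuity of the remaining series in its upper parameter. The connection formula is a
splitting of the Beta integral when `s > 0` (`eulerIntegral_connection`). For negative `s`, where
the Beta integral diverges, it is obtained by descending induction, as both sides satisfy the same
contiguous relation in `s`.
-/

open MeasureTheory Set

/-! ### Termwise integration of the binomial series -/

/-- The binomial series, with its coefficients written as `(a)ₙ / n!`. -/
theorem hasSum_one_sub_rpow_neg (a : ℝ) {v : ℝ} (hv : |v| < 1) :
    HasSum (fun n : ℕ => (ascPochhammer ℝ n).eval a / n.factorial * v ^ n) ((1 - v) ^ (-a)) := by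
  have hmem : v ∈ Metric.eball (0 : ℝ) 1 := by
    simpa [enorm_eq_nnnorm, ← NNReal.coe_lt_coe] using hv
  have h := (Real.one_div_one_sub_rpow_hasFPowerSeriesOnBall_zero a).hasSum hmem
  have h1 : 0 ≤ 1 - v := by linarith [(abs_lt.1 hv).2]
  rw [zero_add, one_div, ← Real.rpow_neg h1] at h
  convert! h using 2 with n
  have hc := Ring.factorial_nsmul_multichoose_eq_ascPochhammer a n
  rw [Ring.multichoose_eq, nsmul_eq_mul, Polynomial.ascPochhammer_smeval_eq_eval] at hc
  have hn : (n.factorial : ℝ) ≠ 0 := by positivity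
  rw [FormalMultilinearSeries.ofScalars_apply_eq, smul_eq_mul, ← hc, mul_div_cancel_left₀ _ hn]

theorem summable_abs_ascPochhammer_div_factorial (a : ℝ) {r : ℝ} (hr0 : 0 ≤ r) (hr : r < 1) :
    Summable (fun n : ℕ => |(ascPochhammer ℝ n).eval a / n.factorial| * r ^ n) := by
  have h := (hasSum_one_sub_rpow_neg a (v := r) (by rwa [abs_of_nonneg hr0])).summable.abs
  simpa [abs_mul, abs_of_nonneg hr0] using h

/-- The binomial series of `(1 - z φ(t))⁻ᵃ` may be integrated termwise against any integrable
weight, so that the integral is a power series in `z`. It serves twice: with `φ(t) = t` it gives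
the Gauss series, and with `φ(t) = t / (1 - w t)` the expansion of Euler's integral about `w`. -/
theorem hasSum_integral_mul_one_sub_rpow_neg (a z : ℝ) {g φ : ℝ → ℝ} {r : ℝ} (hr : r < 1)
    (hg : IntervalIntegrable g volume 0 1) (hφm : Measurable φ)
    (hφ : ∀ t ∈ Ioc (0 : ℝ) 1, |z * φ t| ≤ r) :
    HasSum (fun n : ℕ => (ascPochhammer ℝ n).eval a / n.factorial *
        (∫ t in (0 : ℝ)..1, g t * φ t ^ n) * z ^ n)
      (∫ t in (0 : ℝ)..1, g t * (1 - z * φ t) ^ (-a)) := by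
  have hr0 : 0 ≤ r := (abs_nonneg _).trans (hφ 1 (by simp))
  have hI : uIoc (0 : ℝ) 1 = Ioc 0 1 := uIoc_of_le zero_le_one
  have hsum := summable_abs_ascPochhammer_div_factorial a hr0 hr
  have key := intervalIntegral.hasSum_integral_of_dominated_convergence (μ := volume)
    (a := (0 : ℝ)) (b := 1)
    (F := fun n t => g t * ((ascPochhammer ℝ n).eval a / n.factorial * (z * φ t) ^ n))
    (f := fun t => g t * (1 - z * φ t) ^ (-a))
    (fun n t => |g t| * (|(ascPochhammer ℝ n).eval a / n.factorial| * r ^ n)) ?_ ?_ ?_ ?_ ?_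
  · convert! key using 2 with n
    rw [mul_right_comm, ← intervalIntegral.integral_const_mul]
    refine intervalIntegral.integral_congr fun t _ => ?_
    simp only [mul_pow]
    ring
  · intro n
    refine AEStronglyMeasurable.mul ?_ (by fun_prop)
    rw [hI]
    exact ((intervalIntegrable_iff_integrableOn_Ioc_of_le zero_le_one).1 hg).aestronglyMeasurable
  · refine fun n => Eventually.of_forall fun t ht => ?_
    rw [hI] at ht
    rw [norm_mul, norm_mul, norm_pow]
    simp only [Real.norm_eq_abs]
    gcongr
    exact hφ t ht
  · exact Eventually.of_forall fun t _ => hsum.mul_left _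
  · simp only [tsum_mul_left]
    exact hg.abs.mul_const _
  · refine Eventually.of_forall fun t ht => ?_
    rw [hI] at ht
    exact (hasSum_one_sub_rpow_neg a ((hφ t ht).trans_lt hr)).mul_left _

/-! ### The Beta integral -/

theorem intervalIntegrable_one_sub_rpow {b : ℝ} (hb : 0 < b) :
    IntervalIntegrable (fun t : ℝ => (1 - t) ^ (b - 1)) volume 0 1 := by
  have h := (intervalIntegral.intervalIntegrable_rpow' (a := 0) (b := 1)
    (show -1 < b - 1 by linarith)).comp_sub_left 1
  simpa using h.symm

/-- The real Beta integral. -/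
theorem intervalIntegral_rpow_mul_one_sub_rpow {u v : ℝ} (hu : 0 < u) (hv : 0 < v) :
    ∫ t in (0 : ℝ)..1, t ^ (u - 1) * (1 - t) ^ (v - 1) =
      Real.Gamma u * Real.Gamma v / Real.Gamma (u + v) := by
  rw [← ProbabilityTheory.beta, ProbabilityTheory.beta_eq_betaIntegralReal u v hu hv,
    Complex.betaIntegral, ← Complex.ofReal_re (∫ t in (0 : ℝ)..1, t ^ (u - 1) * (1 - t) ^ (v - 1)),
    ← intervalIntegral.integral_ofReal]
  congr 1
  refine intervalIntegral.integral_congr fun t ht => ?_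
  rw [uIcc_of_le zero_le_one] at ht
  rw [Complex.ofReal_mul, Complex.ofReal_cpow ht.1, Complex.ofReal_cpow (by linarith [ht.2])]
  push_cast
  rfl

theorem Gamma_add_nat_eq_ascPochhammer {b : ℝ} (hb : 0 < b) (n : ℕ) :
    Real.Gamma (b + n) = (ascPochhammer ℝ n).eval b * Real.Gamma b := by
  induction n with
  | zero => simp
  | succ n ih =>
    have : b + n ≠ 0 := by positivity
    rw [Nat.cast_succ, ← add_assoc, Real.Gamma_add_one this, ih, ascPochhammer_succ_eval]
    ring

/-- The moments of the weight `b (1 - t)ᵇ⁻¹` on the unit interval. -/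
theorem integral_one_sub_rpow_mul_pow {b : ℝ} (hb : 0 < b) (n : ℕ) :
    b * ∫ t in (0 : ℝ)..1, (1 - t) ^ (b - 1) * t ^ n =
      n.factorial / (ascPochhammer ℝ n).eval (b + 1) := by
  have h := intervalIntegral_rpow_mul_one_sub_rpow (u := n + 1) (by positivity) hb
  have hG := (Real.Gamma_pos_of_pos hb).ne'
  have e : (∫ t in (0 : ℝ)..1, (1 - t) ^ (b - 1) * t ^ n) =
      ∫ t in (0 : ℝ)..1, t ^ ((n + 1 : ℝ) - 1) * (1 - t) ^ (b - 1) := by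
    refine intervalIntegral.integral_congr fun t ht => ?_
    simp only [add_sub_cancel_right, Real.rpow_natCast]
    ring
  have hp := (ascPochhammer_pos n (b + 1) (by linarith)).ne'
  rw [e, h, Real.Gamma_nat_eq_factorial, show (n + 1 : ℝ) + b = b + 1 + n by ring,
    Gamma_add_nat_eq_ascPochhammer (by linarith), Real.Gamma_add_one hb.ne']
  field_simp

/-! ### Euler's integral and the analytic continuation of the Gauss series -/

theorem one_sub_mul_pos {z t : ℝ} (hz : z < 1) (ht : t ∈ Icc (0 : ℝ) 1) : 0 < 1 - z * t := by
  rcases le_total 0 z with h | h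
  · nlinarith [ht.2]
  · nlinarith [ht.1]

theorem intervalIntegrable_one_sub_rpow_mul_one_sub_mul_rpow (a : ℝ) {b z : ℝ} (hb : 0 < b)
    (hz : z < 1) :
    IntervalIntegrable (fun t : ℝ => (1 - t) ^ (b - 1) * (1 - z * t) ^ (-a)) volume 0 1 := by
  refine (intervalIntegrable_one_sub_rpow hb).mul_continuousOn ?_
  rw [uIcc_of_le zero_le_one]
  exact ContinuousOn.rpow_const (by fun_prop) fun t ht => Or.inl (one_sub_mul_pos hz ht).ne'

/-- Euler's integral for `₂F₁(a, 1; b + 1; z)`, meant for `b > 0` and `z < 1`. The normalizing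
constant `Γ(b + 1) / (Γ(1) Γ(b))` is `b`, and the lower parameter is shifted so that `b > 0` is the
condition for convergence. -/
noncomputable def eulerIntegral (a b z : ℝ) : ℝ :=
  b * ∫ t in (0 : ℝ)..1, (1 - t) ^ (b - 1) * (1 - z * t) ^ (-a)

theorem eulerIntegral_eq_ordinaryHypergeometric (a : ℝ) {b : ℝ} (hb : 0 < b) {z : ℝ}
    (hz : |z| < 1) : eulerIntegral a b z = ₂F₁ a 1 (b + 1) z := by
  have h := (hasSum_integral_mul_one_sub_rpow_neg a z hz (intervalIntegrable_one_sub_rpow hb)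
    measurable_id (fun t ht => by
      rw [abs_mul]
      exact mul_le_of_le_one_right (abs_nonneg z) (abs_le.2 ⟨by simp; linarith [ht.1], ht.2⟩)))
    |>.mul_left b
  rw [eulerIntegral, ordinaryHypergeometric_eq_tsum]
  refine h.tsum_eq.symm.trans (tsum_congr fun n => ?_)
  have hn : (n.factorial : ℝ) ≠ 0 := by positivity
  have hp := (ascPochhammer_pos n (b + 1) (by linarith)).ne'
  have hm := integral_one_sub_rpow_mul_pow hb n
  rw [ascPochhammer_eval_one, smul_eq_mul]
  simp only [id]
  rw [show ∀ A I Z : ℝ, b * (A * I * Z) = A * (b * I) * Z by intros; ring, hm]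
  field_simp

theorem analyticOnNhd_eulerIntegral (a : ℝ) {b : ℝ} (hb : 0 < b) :
    AnalyticOnNhd ℝ (eulerIntegral a b) (Iio 1) := by
  intro w hw
  rw [mem_Iio] at hw
  -- `1 - w t` has a positive lower bound `m` on the unit interval
  obtain ⟨m, hm0, hm⟩ : ∃ m : ℝ, 0 < m ∧ ∀ t ∈ Ioc (0 : ℝ) 1, m ≤ 1 - w * t := by
    refine ⟨min 1 (1 - w), lt_min one_pos (by linarith), fun t ht => ?_⟩
    rcases le_total 0 w with h | h
    · exact (min_le_right _ _).trans (by nlinarith [ht.2])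
    · exact (min_le_left _ _).trans (by nlinarith [ht.1])
  have hg := intervalIntegrable_one_sub_rpow_mul_one_sub_mul_rpow a hb hw
  set c : ℕ → ℝ := fun n => b * ((ascPochhammer ℝ n).eval a / n.factorial *
    ∫ t in (0 : ℝ)..1, (1 - t) ^ (b - 1) * (1 - w * t) ^ (-a) * (t / (1 - w * t)) ^ n) with hc
  suffices h : ∀ᶠ z in 𝓝 (0 : ℝ), HasSum (fun n : ℕ => z ^ n • c n)
      (eulerIntegral a b (w + z)) by
    refine HasFPowerSeriesAt.analyticAt (p := FormalMultilinearSeries.ofScalars ℝ c)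
      (hasFPowerSeriesAt_iff.2 ?_)
    simpa only [FormalMultilinearSeries.coeff_ofScalars] using h
  have hball : ∀ᶠ z in 𝓝 (0 : ℝ), |z| < m / 2 := by
    filter_upwards [Metric.ball_mem_nhds (0 : ℝ) (half_pos hm0)] with z hz
    simpa using hz
  filter_upwards [hball] with z hz
  -- as `|z| < m / 2` and `m ≤ 1 - w t`
  have h2 : ∀ t ∈ Ioc (0 : ℝ) 1, |z * (t / (1 - w * t))| ≤ 1 / 2 := by
    intro t ht
    have h0 := hm0.trans_le (hm t ht)
    rw [abs_mul, abs_div, abs_of_pos ht.1, abs_of_pos h0, ← mul_div_assoc, div_le_iff₀ h0]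
    nlinarith [hm t ht, ht.2, ht.1, abs_nonneg z]
  have h := (hasSum_integral_mul_one_sub_rpow_neg a z (φ := fun t => t / (1 - w * t))
    (by norm_num) hg (by fun_prop) h2).mul_left b
  have e : eulerIntegral a b (w + z) = b * ∫ t in (0 : ℝ)..1,
      (1 - t) ^ (b - 1) * (1 - w * t) ^ (-a) * (1 - z * (t / (1 - w * t))) ^ (-a) := by
    rw [eulerIntegral]
    congr 1
    refine intervalIntegral.integral_congr_ae (Eventually.of_forall fun t ht => ?_)
    rw [uIoc_of_le zero_le_one] at ht
    have h0 := hm0.trans_le (hm t ht)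
    have h1 := (abs_le.1 (h2 t ht)).2
    -- `1 - (w + z) t = (1 - w t) (1 - z t / (1 - w t))`
    rw [mul_assoc, ← Real.mul_rpow h0.le (by linarith)]
    congr 2
    field_simp
    ring
  rw [e]
  convert! h using 2 with n
  simp only [hc, smul_eq_mul]
  ring

theorem gaussF_eq_eulerIntegral (a : ℝ) {b : ℝ} (hb : 0 < b) {z : ℝ} (hz : z < 1) :
    gaussF a 1 (b + 1) z = eulerIntegral a b z :=
  gaussF_eq_of_isGaussContinuation
    ⟨analyticOnNhd_eulerIntegral a hb, fun _ => eulerIntegral_eq_ordinaryHypergeometric a hb⟩ hz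

/-! ### The connection formula for positive parameter -/

/-- A contiguous relation, which lowers `s` by one. It is the integral of the derivative of
`(1 - t)ᵇ (1 + x t)ˢ`. -/
theorem eulerIntegral_contiguous (s : ℝ) {b x : ℝ} (hb : 0 < b) (hx : -1 < x) :
    s * (1 + x) * eulerIntegral (1 - s) b (-x) =
      (b + s) * eulerIntegral (1 - (s + 1)) b (-x) - b := by
  have hz : -x < 1 := by linarith
  have hpos : ∀ t ∈ Icc (0 : ℝ) 1, 0 < 1 - -x * t := fun t => one_sub_mul_pos hz
  have i0 := intervalIntegrable_one_sub_rpow_mul_one_sub_mul_rpow (1 - s) hb hz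
  have i1 := intervalIntegrable_one_sub_rpow_mul_one_sub_mul_rpow (1 - (s + 1)) hb hz
  have key := intervalIntegral.integral_eq_sub_of_hasDerivAt_of_le (a := 0) (b := 1)
    (f := fun t : ℝ => (1 - t) ^ b * (1 - -x * t) ^ s)
    (f' := fun t : ℝ => s * (1 + x) * ((1 - t) ^ (b - 1) * (1 - -x * t) ^ (-(1 - s))) -
      (b + s) * ((1 - t) ^ (b - 1) * (1 - -x * t) ^ (-(1 - (s + 1)))))
    zero_le_one ?_ ?_ ((i0.const_mul _).sub (i1.const_mul _))
  · rw [intervalIntegral.integral_sub (i0.const_mul _) (i1.const_mul _),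
      intervalIntegral.integral_const_mul, intervalIntegral.integral_const_mul] at key
    simp only [sub_self, Real.zero_rpow hb.ne', zero_mul, mul_zero, sub_zero, Real.one_rpow,
      one_mul, zero_sub] at key
    rw [eulerIntegral, eulerIntegral]
    linear_combination b * key
  · refine ContinuousOn.mul (ContinuousOn.rpow_const (by fun_prop) fun t ht => Or.inr hb.le)
      (ContinuousOn.rpow_const (by fun_prop) fun t ht => Or.inl (hpos t ht).ne')
  · intro t ht
    have h0 : 0 < 1 - t := by linarith [ht.2]
    have h1 := hpos t ⟨ht.1.le, ht.2.le⟩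
    have d0 : HasDerivAt (fun t : ℝ => (1 - t) ^ b) (-1 * b * (1 - t) ^ (b - 1)) t :=
      ((hasDerivAt_id t).const_sub 1).rpow_const (Or.inl h0.ne')
    have d1 : HasDerivAt (fun t : ℝ => (1 - -x * t) ^ s)
        (-(-x * 1) * s * (1 - -x * t) ^ (s - 1)) t :=
      (((hasDerivAt_id t).const_mul (-x)).const_sub 1).rpow_const (Or.inl h1.ne')
    refine (d0.mul d1).congr_deriv ?_
    have e0 : (1 - t) ^ b = (1 - t) ^ (b - 1) * (1 - t) := by
      rw [← Real.rpow_add_one h0.ne', sub_add_cancel]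
    have e1 : (1 - -x * t) ^ s = (1 - -x * t) ^ (s - 1) * (1 - -x * t) := by
      rw [← Real.rpow_add_one h1.ne', sub_add_cancel]
    rw [show -(1 - s) = s - 1 by ring, show -(1 - (s + 1)) = s by ring, e0, e1]
    ring

/-- The connection formula between `0` and `∞` for `s > 0`. The substitution
`u = (1 + x t) / (1 + x)` turns Euler's integral into the part of the Beta integral
`∫ uˢ⁻¹ (1 - u)ᵇ⁻¹` over `[1 / (1 + x), 1]`, and `u = (1 - t) / (1 + x)` turns the part over
`[0, 1 / (1 + x)]` into an Euler integral at `-1 / x`. -/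
theorem eulerIntegral_connection {b s x : ℝ} (hb : 0 < b) (hs : 0 < s) (hx : 0 < x) :
    eulerIntegral (1 - s) b (-x) =
      Real.Gamma (b + 1) * Real.Gamma s / Real.Gamma (b + s) * x ^ (-b) * (1 + x) ^ (b + s - 1) -
        b / (s * x) * eulerIntegral (1 - b) s (-(1 / x)) := by
  have hx1 : 0 < 1 + x := by linarith
  set h : ℝ → ℝ := fun u => u ^ (s - 1) * (1 - u) ^ (b - 1) with hh
  set I₁ := ∫ t in (0 : ℝ)..1, (1 - t) ^ (b - 1) * (1 - -x * t) ^ (-(1 - s)) with hI₁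
  set I₂ := ∫ t in (0 : ℝ)..1, (1 - t) ^ (s - 1) * (1 - -(1 / x) * t) ^ (-(1 - b)) with hI₂
  have hδ0 : 0 < 1 / (1 + x) := by positivity
  have hδ1 : 1 / (1 + x) < 1 := by rw [div_lt_one hx1]; linarith
  -- the upper part of the Beta integral
  have e1 : ∫ u in (1 / (1 + x))..1, h u = x ^ b * (1 + x) ^ (1 - b - s) * I₁ := by
    have e := intervalIntegral.smul_integral_comp_add_mul (a := 0) (b := 1) h (x / (1 + x))
      (1 / (1 + x))
    rw [mul_zero, add_zero, show 1 / (1 + x) + x / (1 + x) * 1 = 1 by field_simp] at e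
    rw [← e, smul_eq_mul, hI₁, ← intervalIntegral.integral_const_mul,
      ← intervalIntegral.integral_const_mul]
    refine intervalIntegral.integral_congr fun t ht => ?_
    rw [uIcc_of_le zero_le_one] at ht
    have h0 : 0 ≤ 1 - t := by linarith [ht.2]
    have h1 : 0 < 1 - -x * t := one_sub_mul_pos (by linarith) ht
    simp only [hh]
    rw [show 1 / (1 + x) + x / (1 + x) * t = (1 - -x * t) / (1 + x) by field_simp; ring,
      show 1 - (1 - -x * t) / (1 + x) = x * (1 - t) / (1 + x) by field_simp; ring,
      Real.div_rpow h1.le hx1.le, Real.div_rpow (by positivity) hx1.le, Real.mul_rpow hx.le h0,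
      show -(1 - s) = s - 1 by ring, Real.rpow_sub_one hx.ne' b, Real.rpow_sub_one hx1.ne' s,
      Real.rpow_sub_one hx1.ne' b, show 1 - b - s = 1 - (b + s) by ring, Real.rpow_sub hx1,
      Real.rpow_add hx1, Real.rpow_one]
    field_simp
  -- the lower part of the Beta integral
  have e2 : ∫ u in (0 : ℝ)..(1 / (1 + x)), h u = x ^ b * (1 + x) ^ (1 - b - s) * (I₂ / x) := by
    have e := intervalIntegral.smul_integral_comp_sub_mul (a := 0) (b := 1) h (1 / (1 + x))
      (1 / (1 + x))
    rw [mul_zero, sub_zero, mul_one, sub_self] at e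
    rw [← e, smul_eq_mul, hI₂, ← intervalIntegral.integral_div,
      ← intervalIntegral.integral_const_mul, ← intervalIntegral.integral_const_mul]
    refine intervalIntegral.integral_congr fun t ht => ?_
    rw [uIcc_of_le zero_le_one] at ht
    have h0 : 0 ≤ 1 - t := by linarith [ht.2]
    have h1 : 0 < 1 - -(1 / x) * t :=
      one_sub_mul_pos (by have : 0 < 1 / x := by positivity
                          linarith) ht
    simp only [hh]
    rw [show 1 / (1 + x) - 1 / (1 + x) * t = (1 - t) / (1 + x) by field_simp,
      show 1 - (1 - t) / (1 + x) = x * (1 - -(1 / x) * t) / (1 + x) by field_simp; ring,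
      Real.div_rpow h0 hx1.le, Real.div_rpow (by positivity) hx1.le, Real.mul_rpow hx.le h1.le,
      show -(1 - b) = b - 1 by ring, Real.rpow_sub_one hx.ne' b, Real.rpow_sub_one hx1.ne' s,
      Real.rpow_sub_one hx1.ne' b, show 1 - b - s = 1 - (b + s) by ring, Real.rpow_sub hx1,
      Real.rpow_add hx1, Real.rpow_one]
    field_simp
  have hint : IntervalIntegrable h volume 0 1 := by
    refine IntervalIntegrable.trans (b := 1 / 2) ?_ ?_
    · refine (intervalIntegral.intervalIntegrable_rpow' (by linarith)).mul_continuousOn ?_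
      rw [uIcc_of_le (by norm_num)]
      exact ContinuousOn.rpow_const (by fun_prop) fun t ht => Or.inl (by linarith [ht.2])
    · refine IntervalIntegrable.continuousOn_mul
        ((intervalIntegrable_one_sub_rpow hb).mono_set ?_) ?_
      · rw [uIcc_of_le (by norm_num), uIcc_of_le zero_le_one]
        exact Icc_subset_Icc_left (by norm_num)
      · rw [uIcc_of_le (by norm_num)]
        exact ContinuousOn.rpow_const (by fun_prop) fun t ht => Or.inl (by linarith [ht.1])
  have hsub : uIcc 0 (1 / (1 + x)) ⊆ uIcc (0 : ℝ) 1 ∧ uIcc (1 / (1 + x)) 1 ⊆ uIcc (0 : ℝ) 1 := by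
    rw [uIcc_of_le hδ0.le, uIcc_of_le hδ1.le, uIcc_of_le zero_le_one]
    exact ⟨Icc_subset_Icc_right hδ1.le, Icc_subset_Icc_left hδ0.le⟩
  have hB := intervalIntegral.integral_add_adjacent_intervals (hint.mono_set hsub.1)
    (hint.mono_set hsub.2)
  rw [e1, e2, intervalIntegral_rpow_mul_one_sub_rpow hs hb, add_comm s b] at hB
  have hE₁ : eulerIntegral (1 - s) b (-x) = b * I₁ := rfl
  have hE₂ : eulerIntegral (1 - b) s (-(1 / x)) = s * I₂ := rfl
  have hpow : x ^ (-b) * (1 + x) ^ (b + s - 1) * (x ^ b * (1 + x) ^ (1 - b - s)) = 1 := by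
    rw [mul_mul_mul_comm, ← Real.rpow_add hx, ← Real.rpow_add hx1, neg_add_cancel,
      show b + s - 1 + (1 - b - s) = 0 by ring, Real.rpow_zero, Real.rpow_zero, mul_one]
  rw [hE₁, hE₂, Real.Gamma_add_one hb.ne']
  have e3 : b / (s * x) * (s * I₂) = b * (I₂ / x) := by field_simp
  rw [e3]
  linear_combination (b * x ^ (-b) * (1 + x) ^ (b + s - 1)) * hB - b * (I₂ / x + I₁) * hpow

/-! ### The Gauss series with a unit parameter -/

theorem ascPochhammer_eval_ne_zero {c : ℝ} (hc : ∀ n : ℕ, c ≠ -n) (n : ℕ) :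
    (ascPochhammer ℝ n).eval c ≠ 0 := by
  rw [Ne, ascPochhammer_eval_eq_zero_iff]
  rintro ⟨k, -, hk⟩
  exact hc k (by linarith)

/-- As the second parameter is `1`, it cancels the factorials of the Gauss series. -/
theorem ordinaryHypergeometric_one_eq_tsum (a c v : ℝ) :
    ₂F₁ a 1 c v =
      ∑' n : ℕ, (ascPochhammer ℝ n).eval a / (ascPochhammer ℝ n).eval c * v ^ n := by
  rw [ordinaryHypergeometric_eq_tsum]
  refine tsum_congr fun n => ?_
  have hn : (n.factorial : ℝ) ≠ 0 := by positivity
  rw [ascPochhammer_eval_one, smul_eq_mul]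
  field_simp

theorem summable_factorial_div_ascPochhammer {c v : ℝ} (hc : ∀ n : ℕ, c ≠ -n) (hv : |v| < 1) :
    Summable (fun n : ℕ => |n.factorial / (ascPochhammer ℝ n).eval c * v ^ n|) := by
  rcases eq_or_ne v 0 with rfl | hv0
  · refine summable_of_ne_finset_zero (s := {0}) fun n hn => ?_
    simp only [Finset.mem_singleton] at hn
    simp [hn]
  refine (summable_of_ratio_test_tendsto_lt_one hv (Eventually.of_forall fun n => ?_) ?_).abs
  · have := ascPochhammer_eval_ne_zero hc n
    positivity
  · have h : Tendsto (fun n : ℕ => ((1 + 1 * n) / (c + 1 * n) : ℝ)) atTop (𝓝 (1 / 1)) :=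
      tendsto_add_mul_div_add_mul_atTop_nhds 1 c 1 one_ne_zero
    have h' := (h.mul_const v).norm
    simp only [div_one, one_mul, Real.norm_eq_abs] at h'
    refine h'.congr fun n => ?_
    have h1 := ascPochhammer_eval_ne_zero hc n
    have h2 := ascPochhammer_eval_ne_zero hc (n + 1)
    have h3 : (n.factorial : ℝ) ≠ 0 := by positivity
    rw [Real.norm_eq_abs, Real.norm_eq_abs, ← abs_div]
    congr 1
    rw [ascPochhammer_succ_eval] at h2 ⊢
    have h4 := right_ne_zero_of_mul h2
    rw [Nat.factorial_succ]
    push_cast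
    field_simp
    ring

/-- For `0 < a ≤ 1` the terms of the series are dominated by those with `a = 1`. -/
theorem abs_ascPochhammer_div_le {a : ℝ} (ha0 : 0 < a) (ha1 : a ≤ 1) (c v : ℝ) (n : ℕ) :
    |(ascPochhammer ℝ n).eval a / (ascPochhammer ℝ n).eval c * v ^ n| ≤
      |n.factorial / (ascPochhammer ℝ n).eval c * v ^ n| := by
  have h : (ascPochhammer ℝ n).eval a ≤ n.factorial := by
    rw [← ascPochhammer_eval_one]
    induction n with
    | zero => simp
    | succ n ih =>
      rw [ascPochhammer_succ_eval, ascPochhammer_succ_eval]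
      exact mul_le_mul ih (by linarith) (by positivity) (ascPochhammer_pos n (1 : ℝ) one_pos).le
  have h0 := (ascPochhammer_pos n a ha0).le
  rw [abs_mul, abs_mul, abs_div, abs_div, abs_of_nonneg h0, Nat.abs_cast]
  gcongr

theorem summable_ascPochhammer_div_ascPochhammer {a c v : ℝ} (ha0 : 0 < a) (ha1 : a ≤ 1)
    (hc : ∀ n : ℕ, c ≠ -n) (hv : |v| < 1) :
    Summable (fun n : ℕ => (ascPochhammer ℝ n).eval a / (ascPochhammer ℝ n).eval c * v ^ n) :=
  Summable.of_norm_bounded (summable_factorial_div_ascPochhammer hc hv)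
    (abs_ascPochhammer_div_le ha0 ha1 c v)

/-- The counterpart of `eulerIntegral_contiguous` for the series at `-1 / x`, read off from its
coefficients. Here the lower parameter `c` need not be positive. -/
theorem ordinaryHypergeometric_one_contiguous {a c v : ℝ} (ha0 : 0 < a) (ha1 : a ≤ 1)
    (hc : ∀ n : ℕ, c ≠ -n) (hv : |v| < 1) :
    (v - 1) * ₂F₁ a 1 c v = (c - a) / c * v * ₂F₁ a 1 (c + 1) v - 1 := by
  have hc' : ∀ n : ℕ, c + 1 ≠ -n := fun n h => hc (n + 1) (by push_cast; linarith)
  have hs := summable_ascPochhammer_div_ascPochhammer ha0 ha1 hc hv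
  have e := hs.tsum_eq_zero_add
  have hsv := hs.mul_left v
  have hs' := (summable_nat_add_iff 1).2 hs
  rw [ordinaryHypergeometric_one_eq_tsum, ordinaryHypergeometric_one_eq_tsum]
  have key : v * (∑' n : ℕ, (ascPochhammer ℝ n).eval a / (ascPochhammer ℝ n).eval c * v ^ n) -
      (∑' n : ℕ, (ascPochhammer ℝ (n + 1)).eval a / (ascPochhammer ℝ (n + 1)).eval c *
        v ^ (n + 1)) = (c - a) / c * v *
      ∑' n : ℕ, (ascPochhammer ℝ n).eval a / (ascPochhammer ℝ n).eval (c + 1) * v ^ n := by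
    rw [← tsum_mul_left, ← tsum_mul_left, ← hsv.tsum_sub hs']
    refine tsum_congr fun n => ?_
    have hc0 : c ≠ 0 := by simpa using hc 0
    have h1 := ascPochhammer_eval_ne_zero hc n
    have h2 := ascPochhammer_eval_ne_zero hc' n
    have h3 : c + n ≠ 0 := fun h => hc n (by linarith)
    have h4 : c * (ascPochhammer ℝ n).eval (c + 1) = (ascPochhammer ℝ n).eval c * (c + n) := by
      rw [← ascPochhammer_succ_eval, ascPochhammer_succ_left]
      simp [Polynomial.eval_comp]
    rw [ascPochhammer_succ_eval, ascPochhammer_succ_eval, ← h4]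
    have h5 : (ascPochhammer ℝ n).eval (c + 1) = (ascPochhammer ℝ n).eval c * (c + n) / c := by
      rw [eq_div_iff hc0, ← h4]; ring
    rw [h5]
    field_simp
    ring
  simp only [ascPochhammer_zero, Polynomial.eval_one, pow_zero, div_one, mul_one] at e
  linear_combination key - e

/-! ### The connection formula in general -/

/-- The connection formula for every `s` that is not a non-positive integer: the contiguous relations
of both sides carry it from `s + 1` to `s`, starting from positive `s`. -/
theorem eulerIntegral_eq_connection {b s x : ℝ} (hb0 : 0 < b) (hb1 : b < 1)
    (hs : ∀ n : ℕ, s ≠ -n) (hx : 1 < x) :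
    eulerIntegral (1 - s) b (-x) =
      Real.Gamma (b + 1) * Real.Gamma s / Real.Gamma (b + s) * x ^ (-b) * (1 + x) ^ (b + s - 1) -
        b / (s * x) * ₂F₁ (1 - b) 1 (s + 1) (-(1 / x)) := by
  have hx0 : 0 < x := by linarith
  have hx1 : 0 < 1 + x := by linarith
  have hv : |-(1 / x)| < 1 := by
    rw [abs_neg, abs_of_pos (by positivity), div_lt_one hx0]
    exact hx
  obtain ⟨n, hn⟩ := exists_nat_gt (-s)
  induction n generalizing s with
  | zero =>
    have hs0 : 0 < s := by simpa using hn
    rw [eulerIntegral_connection hb0 hs0 hx0,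
      eulerIntegral_eq_ordinaryHypergeometric (1 - b) hs0 hv]
  | succ n ih =>
    have hs0 : s ≠ 0 := by simpa using hs 0
    have hs' : ∀ n : ℕ, s + 1 ≠ -n := fun n h => hs (n + 1) (by push_cast; linarith)
    have hs1 : s + 1 ≠ 0 := by simpa using hs' 0
    have IH := ih hs' (by push_cast at hn; linarith)
    have hE := eulerIntegral_contiguous s hb0 (show -1 < x by linarith)
    have hF := ordinaryHypergeometric_one_contiguous (a := 1 - b) (by linarith) (by linarith)
      hs' hv
    -- also at `b + s = 0`, where `Γ` takes the value zero
    have hG : (b + s) * (Real.Gamma s * s / Real.Gamma (b + (s + 1))) =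
        s * (Real.Gamma s / Real.Gamma (b + s)) := by
      rcases eq_or_ne (b + s) 0 with h | h
      · simp [h]
      · rw [← add_assoc, Real.Gamma_add_one h]
        field_simp
    rw [Real.Gamma_add_one hs0, show b + (s + 1) - 1 = b + s - 1 + 1 by ring,
      Real.rpow_add_one hx1.ne'] at IH
    have h2 : s * (1 + x) ≠ 0 := mul_ne_zero hs0 hx1.ne'
    refine mul_left_cancel₀ h2 (hE.trans ?_)
    rw [IH]
    have hF' : (1 + x) / x * ₂F₁ (1 - b) 1 (s + 1) (-(1 / x)) =
        (b + s) / ((s + 1) * x) * ₂F₁ (1 - b) 1 (s + 1 + 1) (-(1 / x)) + 1 := by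
      have e1 : (1 + x) / x = 1 / x + 1 := by field_simp
      have e2 : (b + s) / ((s + 1) * x) = (s + 1 - (1 - b)) / (s + 1) * (1 / x) := by
        field_simp; ring
      rw [e1, e2]
      linear_combination -hF
    have e3 : s * (1 + x) * (b / (s * x) * ₂F₁ (1 - b) 1 (s + 1) (-(1 / x))) =
        b * ((1 + x) / x * ₂F₁ (1 - b) 1 (s + 1) (-(1 / x))) := by field_simp
    rw [mul_sub, mul_sub, e3, hF']
    have e4 : b / ((s + 1) * x) * (b + s) = b * ((b + s) / ((s + 1) * x)) := by field_simp
    linear_combination (Real.Gamma (b + 1) * x ^ (-b) * (1 + x) ^ (b + s - 1) * (1 + x)) * hG -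
      ₂F₁ (1 - b) 1 (s + 1 + 1) (-(1 / x)) * e4

/-! ### Continuity in the parameters -/

theorem tendsto_ordinaryHypergeometric_one {c v : ℝ} (hc : ∀ n : ℕ, c ≠ -n) (hv : |v| < 1) :
    Tendsto (fun a : ℝ => ₂F₁ a 1 c v) (𝓝[<] 1) (𝓝 (₂F₁ (1 : ℝ) 1 c v)) := by
  simp only [ordinaryHypergeometric_one_eq_tsum]
  refine tendsto_tsum_of_dominated_convergence (summable_factorial_div_ascPochhammer hc hv)
    (fun n => ?_) ?_
  · have : Continuous fun a : ℝ =>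
        (ascPochhammer ℝ n).eval a / (ascPochhammer ℝ n).eval c * v ^ n := by fun_prop
    exact this.continuousAt.tendsto.mono_left nhdsWithin_le_nhds
  · filter_upwards [Ioo_mem_nhdsLT (zero_lt_one' ℝ)] with a ha n
    exact abs_ascPochhammer_div_le ha.1 ha.2.le c v n

/-- Dominated convergence; for `b ≥ 1 / 2` the weight is bounded by `(1 - t) ^ (-1 / 2)`. -/
theorem tendsto_eulerIntegral_one (a : ℝ) {z : ℝ} (hz : z < 1) :
    Tendsto (fun b : ℝ => eulerIntegral a b z) (𝓝[<] 1) (𝓝 (eulerIntegral a 1 z)) := by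
  have hI : uIoc (0 : ℝ) 1 = Ioc 0 1 := uIoc_of_le zero_le_one
  refine (tendsto_id.mono_left nhdsWithin_le_nhds).mul ?_
  refine intervalIntegral.tendsto_integral_filter_of_dominated_convergence
    (fun t => (1 - t) ^ ((1 / 2 : ℝ) - 1) * (1 - z * t) ^ (-a)) ?_ ?_
    (intervalIntegrable_one_sub_rpow_mul_one_sub_mul_rpow a (by norm_num) hz) ?_
  · refine Eventually.of_forall fun b => Measurable.aestronglyMeasurable ?_
    fun_prop
  · filter_upwards [Ioo_mem_nhdsLT (show (1 / 2 : ℝ) < 1 by norm_num)] with b hb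
    refine Eventually.of_forall fun t ht => ?_
    rw [hI] at ht
    have h1 := one_sub_mul_pos hz ⟨ht.1.le, ht.2⟩
    rw [norm_mul, Real.norm_of_nonneg (Real.rpow_nonneg h1.le _),
      Real.norm_of_nonneg (Real.rpow_nonneg (by linarith [ht.2]) _)]
    refine mul_le_mul_of_nonneg_right ?_ (Real.rpow_nonneg h1.le _)
    rcases ht.2.eq_or_lt with h | h
    -- at `t = 1` both powers of zero have a nonzero exponent, hence the value `0`
    · rw [h, sub_self, Real.zero_rpow (by linarith [hb.2]), Real.zero_rpow (by norm_num)]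
    · exact Real.rpow_le_rpow_of_exponent_ge (by linarith) (by linarith [ht.1])
        (by linarith [hb.1])
  -- at `t = 1` there is no convergence: `0 ^ (b - 1) = 0` for `b < 1`, while `0 ^ 0 = 1`
  · have hne : ∀ᵐ t : ℝ, t ≠ 1 := Measure.ae_ne volume 1
    filter_upwards [hne] with t ht1 ht
    rw [hI] at ht
    have h0 : 0 < 1 - t := by have := lt_of_le_of_ne ht.2 ht1; linarith
    refine Tendsto.mul_const _ ?_
    have : Continuous fun b : ℝ => (1 - t) ^ (b - 1) :=
      continuous_const.rpow (by fun_prop) fun _ => Or.inl h0.ne'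
    exact this.continuousAt.tendsto.mono_left nhdsWithin_le_nhds

/-- For `b = 1` Euler's integral is elementary. -/
theorem mul_eulerIntegral_one (s : ℝ) {x : ℝ} (hx : -1 < x) :
    s * x * eulerIntegral (1 - s) 1 (-x) = (1 + x) ^ s - 1 := by
  have hz : -x < 1 := by linarith
  have hpos : ∀ t ∈ Icc (0 : ℝ) 1, 0 < 1 - -x * t := fun t => one_sub_mul_pos hz
  have i0 := intervalIntegrable_one_sub_rpow_mul_one_sub_mul_rpow (1 - s) one_pos hz
  have key := intervalIntegral.integral_eq_sub_of_hasDerivAt_of_le (a := 0) (b := 1)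
    (f := fun t : ℝ => (1 - -x * t) ^ s)
    (f' := fun t : ℝ => s * x * ((1 - t) ^ ((1 : ℝ) - 1) * (1 - -x * t) ^ (-(1 - s))))
    zero_le_one ?_ ?_ (i0.const_mul _)
  · rw [intervalIntegral.integral_const_mul] at key
    rw [eulerIntegral, one_mul, key]
    simp
  · exact ContinuousOn.rpow_const (by fun_prop) fun t ht => Or.inl (hpos t ht).ne'
  · intro t ht
    have h1 := hpos t ⟨ht.1.le, ht.2.le⟩
    have d1 : HasDerivAt (fun t : ℝ => (1 - -x * t) ^ s)
        (-(-x * 1) * s * (1 - -x * t) ^ (s - 1)) t :=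
      (((hasDerivAt_id t).const_mul (-x)).const_sub 1).rpow_const (Or.inl h1.ne')
    refine d1.congr_deriv ?_
    rw [sub_self, Real.rpow_zero, neg_sub]
    ring

/-! ### The limits of the utility function -/

theorem lfrraUtility_eq_eulerIntegral (α σ K C : ℝ) {β q : ℝ} (hβ : β < 1)
    (hq : 0 < 1 + α * σ * q) :
    lfrraUtility α β σ K C q =
      K * σ / (σ - 1) * (1 + α * σ * q) ^ (β - 1 / σ) * q ^ (1 - β) *
        (1 + (β - 1 / σ) / (1 - β) * eulerIntegral (1 - 1 / σ) (1 - β) (-(α * σ * q))) + C := by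
  rw [lfrraUtility, show 2 - β = 1 - β + 1 by ring,
    gaussF_eq_eulerIntegral _ (by linarith) (by linarith)]

theorem tendsto_lfrraUtility_hara {α σ : ℝ} (K C : ℝ) (hα : α ≠ 0) (hσ : σ ≠ 0) (hσ1 : σ ≠ 1)
    {q : ℝ} (hq0 : 0 ≤ q) (hq : 0 < 1 + α * σ * q) :
    Tendsto (fun β : ℝ => lfrraUtility α β σ K C q) (𝓝[>] 0) (𝓝 (haraUtility α σ K C q)) := by
  have hσ1' : σ - 1 ≠ 0 := sub_ne_zero.2 hσ1
  have hmem : Ioo (0 : ℝ) 1 ∈ 𝓝[>] (0 : ℝ) := Ioo_mem_nhdsGT one_pos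
  rcases hq0.eq_or_lt with rfl | hq0
  -- at `q = 0` both sides are `C`
  · refine Tendsto.congr' (f₁ := fun _ => C) ?_ (by simp [haraUtility])
    filter_upwards [hmem] with β hβ
    rw [lfrraUtility, Real.zero_rpow (by linarith [hβ.2])]
    ring
  have hlt : Tendsto (fun β : ℝ => 1 - β) (𝓝[>] 0) (𝓝[<] 1) := by
    refine tendsto_nhdsWithin_iff.2 ⟨?_, ?_⟩
    · have : Continuous fun β : ℝ => 1 - β := by fun_prop
      simpa using (this.tendsto 0).mono_left nhdsWithin_le_nhds
    · filter_upwards [hmem] with β hβ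
      rw [mem_Iio]
      linarith [hβ.1]
  have hE := (tendsto_eulerIntegral_one (1 - 1 / σ)
    (show -(α * σ * q) < 1 by linarith)).comp hlt
  have hβ0 : Tendsto (fun β : ℝ => β) (𝓝[>] 0) (𝓝 0) := nhdsWithin_le_nhds
  have h1 : Tendsto (fun β : ℝ => (1 + α * σ * q) ^ (β - 1 / σ)) (𝓝[>] 0)
      (𝓝 ((1 + α * σ * q) ^ (0 - 1 / σ))) :=
    tendsto_const_nhds.rpow (hβ0.sub_const _) (Or.inl hq.ne')
  have h2 : Tendsto (fun β : ℝ => q ^ (1 - β)) (𝓝[>] 0) (𝓝 (q ^ (1 - 0 : ℝ))) :=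
    tendsto_const_nhds.rpow (hβ0.const_sub _) (Or.inl hq0.ne')
  have h3 : Tendsto (fun β : ℝ => (β - 1 / σ) / (1 - β)) (𝓝[>] 0)
      (𝓝 ((0 - 1 / σ) / (1 - 0))) := (hβ0.sub_const _).div (hβ0.const_sub _) (by norm_num)
  have h := ((((h1.const_mul (K * σ / (σ - 1))).mul h2).mul ((h3.mul hE).const_add 1)).add_const C)
  have hval : K * σ / (σ - 1) * (1 + α * σ * q) ^ (0 - 1 / σ) * q ^ (1 - 0 : ℝ) *
      (1 + (0 - 1 / σ) / (1 - 0) * eulerIntegral (1 - 1 / σ) 1 (-(α * σ * q))) + C =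
      haraUtility α σ K C q := by
    have hm := mul_eulerIntegral_one (1 / σ) (show -1 < α * σ * q by linarith)
    have hp : (1 + α * σ * q) ^ (0 - 1 / σ) * (1 + α * σ * q) ^ (1 / σ) = 1 := by
      rw [← Real.rpow_add hq]
      simp
    have hp' : (1 + α * σ * q) ^ ((σ - 1) / σ) =
        (1 + α * σ * q) ^ (0 - 1 / σ) * (1 + α * σ * q) := by
      rw [← Real.rpow_add_one hq.ne']
      congr 1
      field_simp
      ring
    have hx : α * σ * q ≠ 0 := by positivity
    have hE' : eulerIntegral (1 - 1 / σ) 1 (-(α * σ * q)) =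
        ((1 + α * σ * q) ^ (1 / σ) - 1) / (1 / σ * (α * σ * q)) := by
      rw [eq_div_iff (by positivity), ← hm]
      ring
    rw [haraUtility, hE', hp']
    generalize (1 + α * σ * q) ^ (0 - 1 / σ) = P at hp ⊢
    generalize (1 + α * σ * q) ^ (1 / σ) = Q at hp ⊢
    rw [sub_zero, Real.rpow_one]
    have e : K * σ / (σ - 1) * P * q * (1 + (0 - 1 / σ) / 1 *
        ((Q - 1) / (1 / σ * (α * σ * q)))) =
        K / (α * (σ - 1)) * (P * (α * σ * q) - P * Q + P) := by
      field_simp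
      ring
    rw [e, hp]
    ring
  rw [hval] at h
  refine h.congr' ?_
  filter_upwards [hmem] with β hβ
  exact (lfrraUtility_eq_eulerIntegral α σ K C hβ.2 hq).symm

/-- With the additive constant shifted, the utility function is free of Gamma functions: the shift is
the opposite of the contribution of the first term of the connection formula. -/
theorem lfrraUtility_add_cremrShift {α σ : ℝ} (K C : ℝ)
    (hs : ∀ n : ℕ, 1 / σ ≠ -n) {β q : ℝ} (hβ0 : 0 < β) (hβ1 : β < 1) (hq0 : 0 < q)
    (hx : 1 < α * σ * q) :
    lfrraUtility α β σ K (cremrShift α β σ K + C) q =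
      K * σ / (σ - 1) * (1 + α * σ * q) ^ (β - 1 / σ) * q ^ (1 - β) *
        (1 - (β - 1 / σ) / (1 / σ * (α * σ * q)) *
          ₂F₁ β 1 (1 + 1 / σ) (-(1 / (α * σ * q)))) + C := by
  have hb : 1 - β ≠ 0 := by linarith
  have hx1 : 0 < 1 + α * σ * q := by linarith
  have hασ : 0 < α * σ := pos_of_mul_pos_left (zero_lt_one.trans hx) hq0.le
  rw [lfrraUtility_eq_eulerIntegral α σ K _ hβ1 hx1,
    eulerIntegral_eq_connection (by linarith) (by linarith) hs hx, cremrShift]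
  have hs0 : 1 / σ ≠ 0 := by simpa using hs 0
  rw [sub_sub_cancel, add_comm (1 / σ) 1]
  generalize ₂F₁ β 1 (1 + 1 / σ) (-(1 / (α * σ * q))) = F
  generalize 1 / σ = s at *
  -- also at `β = s`, where both sides vanish because `Γ 0 = 0`
  have hG : (β - s) * (Real.Gamma s / Real.Gamma (1 - β + s)) =
      -(Real.Gamma s / Real.Gamma (s - β)) := by
    rcases eq_or_ne (s - β) 0 with h | h
    · rw [h, Real.Gamma_zero, div_zero, neg_zero, show β - s = 0 by linarith, zero_mul]
    · rw [show 1 - β + s = s - β + 1 by ring, Real.Gamma_add_one h]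
      field_simp
      ring
  have hP : (1 + α * σ * q) ^ (β - s) * (1 + α * σ * q) ^ (1 - β + s - 1) = 1 := by
    rw [← Real.rpow_add hx1, show β - s + (1 - β + s - 1) = 0 by ring, Real.rpow_zero]
  have hQ : q ^ (1 - β) * (α * σ * q) ^ (-(1 - β)) = (1 / (α * σ)) ^ (1 - β) := by
    rw [Real.rpow_neg (by positivity), ← Real.inv_rpow (by positivity),
      ← Real.mul_rpow hq0.le (by positivity)]
    congr 1
    field_simp
  rw [Real.Gamma_add_one hb]
  have e : (β - s) / (1 - β) * ((1 - β) * Real.Gamma (1 - β) * Real.Gamma s /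
      Real.Gamma (1 - β + s) * (α * σ * q) ^ (-(1 - β)) * (1 + α * σ * q) ^ (1 - β + s - 1) -
        (1 - β) / (s * (α * σ * q)) * F) =
      (β - s) * (Real.Gamma s / Real.Gamma (1 - β + s)) * Real.Gamma (1 - β) *
        (α * σ * q) ^ (-(1 - β)) * (1 + α * σ * q) ^ (1 - β + s - 1) -
        (β - s) / (s * (α * σ * q)) * F := by
    field_simp
  rw [e, hG, ← hQ]
  linear_combination (-(K * σ / (σ - 1)) * q ^ (1 - β) * (α * σ * q) ^ (-(1 - β)) *
    (Real.Gamma s / Real.Gamma (s - β)) * Real.Gamma (1 - β)) * hP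

theorem tendsto_lfrraUtility_cremr {α σ : ℝ} (K C : ℝ)
    (hs : ∀ n : ℕ, 1 / σ ≠ -n) {q : ℝ} (hq0 : 0 < q) (hx : 1 < α * σ * q) :
    Tendsto (fun β : ℝ => lfrraUtility α β σ K (cremrShift α β σ K + C) q) (𝓝[<] 1)
      (𝓝 (cremrUtility α σ K C q)) := by
  have hσ : σ ≠ 0 := by
    rintro rfl
    simpa using hs 0
  have hq : 0 < 1 + α * σ * q := by linarith
  have hx0 : 0 < α * σ * q := by linarith
  have hα : α ≠ 0 := by
    rintro rfl
    simp at hx0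
  have hv : |-(1 / (α * σ * q))| < 1 := by
    rw [abs_neg, abs_of_pos (by positivity), div_lt_one hx0]
    exact hx
  have hF := tendsto_ordinaryHypergeometric_one (c := 1 + 1 / σ)
    (fun n h => hs (n + 1) (by push_cast; linarith)) hv
  have hβ1 : Tendsto (fun β : ℝ => β) (𝓝[<] 1) (𝓝 1) := nhdsWithin_le_nhds
  have h1 : Tendsto (fun β : ℝ => (1 + α * σ * q) ^ (β - 1 / σ)) (𝓝[<] 1)
      (𝓝 ((1 + α * σ * q) ^ (1 - 1 / σ))) :=
    tendsto_const_nhds.rpow (hβ1.sub_const _) (Or.inl hq.ne')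
  have h2 : Tendsto (fun β : ℝ => q ^ (1 - β)) (𝓝[<] 1) (𝓝 (q ^ (1 - 1 : ℝ))) :=
    tendsto_const_nhds.rpow (hβ1.const_sub _) (Or.inl hq0.ne')
  have h3 := ((hβ1.sub_const (1 / σ)).div_const (1 / σ * (α * σ * q))).mul hF
  have h := (((h1.const_mul (K * σ / (σ - 1))).mul h2).mul (h3.const_sub 1)).add_const C
  have hval : K * σ / (σ - 1) * (1 + α * σ * q) ^ (1 - 1 / σ) * q ^ (1 - 1 : ℝ) *
      (1 - (1 - 1 / σ) / (1 / σ * (α * σ * q)) *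
        ₂F₁ (1 : ℝ) 1 (1 + 1 / σ) (-(1 / (α * σ * q)))) + C = cremrUtility α σ K C q := by
    have e : (1 - 1 / σ) / (1 / σ * (α * σ * q)) = (σ - 1) / (α * σ) / q := by
      field_simp
    rw [cremrUtility, e, sub_self, Real.rpow_zero]
    field_simp
  rw [hval] at h
  refine h.congr' ?_
  filter_upwards [Ioo_mem_nhdsLT (zero_lt_one' ℝ)] with β hβ
  exact (lfrraUtility_add_cremrShift K C hs hβ.1 hβ.2 hq0 hx).symm

theorem theorem2 (α σ K C : ℝ) (hα : α ≠ 0) (hσ : σ ≠ 0) (hσ1 : σ ≠ 1) (hK : 0 < K) :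
    (∀ q : ℝ, 0 ≤ q → 0 < 1 + α * σ * q →
      Tendsto (fun β : ℝ => lfrraUtility α β σ K C q) (𝓝[>] 0)
        (𝓝 (haraUtility α σ K C q))) ∧
    ((∀ n : ℕ, 1 + 1 / σ ≠ -(n : ℝ)) →
      ∀ q : ℝ, 0 < q → 0 < 1 + α * σ * q → |-(1 / (α * σ * q))| < 1 →
        Tendsto (fun β : ℝ => lfrraUtility α β σ K (cremrShift α β σ K + C) q) (𝓝[<] 1)
          (𝓝 (cremrUtility α σ K C q))) := by
  refine ⟨fun q hq0 hq => tendsto_lfrraUtility_hara K C hα hσ hσ1 hq0 hq,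
    fun hs q hq0 hq hx => tendsto_lfrraUtility_cremr K C (fun n => ?_) hq0 ?_⟩
  · rcases n with _ | n
    · simpa using hσ
    · intro h
      exact hs n (by rw [h]; push_cast; ring)
  · -- `|α σ q| > 1` and `α σ q > -1`
    have hne : α * σ * q ≠ 0 := by positivity
    rw [abs_neg, abs_div, abs_one, div_lt_one (abs_pos.2 hne)] at hx
    rcases lt_abs.1 hx with h | h
    · exact h
    · linarith
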